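/- All vector lattices are real. A vector lattice $E$ is Archimedean if $x\ge 0$ and $nx\le y$ for all $n\in\mathbb{N}$ imply $x=0$. A sequence $(f_n)$ in $E$ converges relatively uniformly to $f\in E$ if there is $0<p\in E$ such that for every real $\epsilon>0$ there is $N$ with $|f_n-f|<\epsilon p$ for all $n\ge N$; it is relatively uniformly Cauchy if there is $0<p\in E$ such that for every real $\epsilon>0$ there is $N$ with $|f_m-f_n|<\epsilon p$ for all $m,n\ge N$; and $E$ is uniformly complete if every relatively uniformly Cauchy sequence in $E$ converges relatively uniformly in $E$. A uniform completion of an Archimedean vector lattice $E$ is a pair $(E^u,\phi)$ where $E^u$ is a uniformly complete Archimedean vector lattice, $\phi:E\to E^u$ is an injective vector lattice homomorphism, and for every vector lattice homomorphism $S$ from $E$ to a uniformly complete Archimedean vector lattice $G$ there is a unique vector lattice homomorphism $S^u:E^u\to G$ with $S^u\circ\phi=S$. For $m\ge 1$ let $\mathcal{H}(\mathbb{R}^m)$ be the set of continuous functions $h:\mathbb{R}^m\to\mathbb{R}$ with $h(\lambda x)=\lambda h(x)$ for all real $\lambda\ge 0$ and all $x\in\mathbb{R}^m$. For $h\in\mathcal{H}(\mathbb{R}^m)$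 and elements $a_1,\dots,a_m,b$ of an Archimedean vector lattice, write $h(a_1,\dots,a_m)=b$ if $h(\omega(a_1),\dots,\omega(a_m))=\omega(b)$ for every nonzero real-valued vector lattice homomorphism $\omega$ on the vector sublattice generated by $a_1,\dots,a_m,b$. Let $\mathcal{D}$ be a nonempty subset of $\bigcup_{m\ge1}\mathcal{H}(\mathbb{R}^m)$. For an Archimedean vector lattice $E$ with uniform completion $(E^u,\phi)$ put $E_{(1)}=\phi(E)$, let $E_{(n+1)}$ be the vector sublattice of $E^u$ generated by $E_{(n)}$ together with all $b\in E^u$ such that $b=h(a_1,\dots,a_m)$ for some $h\in\mathcal{D}\cap\mathcal{H}(\mathbb{R}^m)$, $m\ge 1$, and some $a_1,\dots,a_m\in E_{(n)}$, and set $E^{\mathcal{D}}=\bigcup_{n\ge1}E_{(n)}$. Then $E^{\mathcal{D}}$ is a vector sublattice of $E^u$ that contains $\phi(E)$. Proposition 3.17. Let $s\ge 1$, let $E_1,\dots,E_s,F$ be Archimedean vector lattices with $F$ uniformly complete, let $(E_k^u,\phi_k)$ be a uniform completion of $E_k$ for $k=1,\dots,s$, and let $\mathcal{D}$ be a nonempty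 subset of $\bigcup_{m\ge1}\mathcal{H}(\mathbb{R}^m)$. If $T:E_1\times\dots\times E_s\to F$ is a positive $s$-linear map (that is, linear in each variable, with $T(f_1,\dots,f_s)\ge0$ whenever all $f_k\ge0$), then there exists a unique positive $s$-linear map $T^{\mathcal{D}}:E_1^{\mathcal{D}}\times\dots\times E_s^{\mathcal{D}}\to F$ such that $T^{\mathcal{D}}(\phi_1(f_1),\dots,\phi_s(f_s))=T(f_1,\dots,f_s)$ for all $f_k\in E_k$, $k=1,\dots,s$. -/

import Mathlib

/-- `E` is an Archimedean (real) vector lattice: an ordered real vector space whose order is a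
lattice order, such that `n x ≤ y` for all `n` (with `x ≥ 0`) forces `x = 0`. (Mathlib's class
`Archimedean` is a different notion outside linear orders: it makes every `y > 0` an order unit.) -/
class IsArchimedeanVectorLattice (E : Type*) [AddCommGroup E] [Module ℝ E] [Lattice E] : Prop
    extends IsOrderedAddMonoid E, IsOrderedModule ℝ E where
  eq_zero_of_nsmul_le : ∀ x y : E, 0 ≤ x → (∀ n : ℕ, n • x ≤ y) → x = 0

/-- Vector lattice homomorphisms: linear maps that preserve the lattice operations. -/
structure VectorLatticeHom (E F : Type*) [AddCommGroup E] [Module ℝ E] [Lattice E]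
    [AddCommGroup F] [Module ℝ F] [Lattice F] extends E →ₗ[ℝ] F where
  map_sup' : ∀ x y : E, toFun (x ⊔ y) = toFun x ⊔ toFun y
  map_inf' : ∀ x y : E, toFun (x ⊓ y) = toFun x ⊓ toFun y

instance VectorLatticeHom.instCoeFun {E F : Type*} [AddCommGroup E] [Module ℝ E] [Lattice E]
    [AddCommGroup F] [Module ℝ F] [Lattice F] :
    CoeFun (VectorLatticeHom E F) (fun _ => E → F) :=
  ⟨fun T => T.toLinearMap⟩

/-- Vector sublattices: linear subspaces closed under the lattice operations of the ambient
vector lattice. -/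
structure VectorSublattice (E : Type*) [AddCommGroup E] [Module ℝ E] [Lattice E]
    extends Submodule ℝ E where
  sup_mem' : ∀ ⦃x y : E⦄, x ∈ carrier → y ∈ carrier → x ⊔ y ∈ carrier
  inf_mem' : ∀ ⦃x y : E⦄, x ∈ carrier → y ∈ carrier → x ⊓ y ∈ carrier

namespace VectorSublattice

variable {E : Type*} [AddCommGroup E] [Module ℝ E] [Lattice E]

/-- A vector sublattice, viewed as a type. -/
instance instCoeSort : CoeSort (VectorSublattice E) (Type _) := ⟨fun L => L.toSubmodule⟩

/-- The lattice operations and the order are those of the ambient space. -/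
instance instLattice (L : VectorSublattice E) : Lattice L.toSubmodule :=
  Subtype.lattice (fun _ _ hx hy => L.sup_mem' hx hy) (fun _ _ hx hy => L.inf_mem' hx hy)

instance instIsArchimedeanVectorLattice [IsArchimedeanVectorLattice E] (L : VectorSublattice E) :
    IsArchimedeanVectorLattice L.toSubmodule where
  add_le_add_left := fun a b hab c =>
    (add_le_add_left (show (a : E) ≤ b from hab) (c : E) : (a : E) + c ≤ b + c)
  smul_le_smul_of_nonneg_left := fun r hr a b hab =>
    (smul_le_smul_of_nonneg_left (show (a : E) ≤ b from hab) hr : r • (a : E) ≤ r • (b : E))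
  smul_le_smul_of_nonneg_right := fun a ha r t hrt =>
    (smul_le_smul_of_nonneg_right hrt (show (0 : E) ≤ a from ha) : r • (a : E) ≤ t • (a : E))
  eq_zero_of_nsmul_le := fun x y hx h =>
    Subtype.ext (IsArchimedeanVectorLattice.eq_zero_of_nsmul_le (x : E) (y : E) hx (fun n => h n))

/-- The vector sublattice generated by a set: the intersection of all vector sublattices
containing it. -/
def generated (A : Set E) : VectorSublattice E where
  carrier := {x | ∀ L : VectorSublattice E, A ⊆ L.carrier → x ∈ L.carrier}
  zero_mem' := fun L _ => L.zero_mem'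
  add_mem' := fun hx hy L hL => L.add_mem' (hx L hL) (hy L hL)
  smul_mem' := fun c _ hx L hL => L.smul_mem' c (hx L hL)
  sup_mem' := fun _ _ hx hy L hL => L.sup_mem' (hx L hL) (hy L hL)
  inf_mem' := fun _ _ hx hy L hL => L.inf_mem' (hx L hL) (hy L hL)

theorem subset_generated (A : Set E) : A ⊆ (generated A).carrier :=
  fun _ hx _ hL => hL hx

/-- The range of a vector lattice homomorphism. -/
def range {F : Type*} [AddCommGroup F] [Module ℝ F] [Lattice F] (φ : VectorLatticeHom E F) :
    VectorSublattice F where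
  toSubmodule := LinearMap.range φ.toLinearMap
  sup_mem' := by
    rintro _ _ ⟨x, rfl⟩ ⟨y, rfl⟩
    exact ⟨x ⊔ y, φ.map_sup' x y⟩
  inf_mem' := by
    rintro _ _ ⟨x, rfl⟩ ⟨y, rfl⟩
    exact ⟨x ⊓ y, φ.map_inf' x y⟩

end VectorSublattice

/-- `f n → g` relatively uniformly. -/
def RUConverges {E : Type*} [AddCommGroup E] [Module ℝ E] [Lattice E] (f : ℕ → E) (g : E) : Prop :=
  ∃ p : E, 0 < p ∧ ∀ ε : ℝ, 0 < ε → ∃ N : ℕ, ∀ n ≥ N, |f n - g| < ε • p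

/-- `f` is a relatively uniformly Cauchy sequence. -/
def RUCauchy {E : Type*} [AddCommGroup E] [Module ℝ E] [Lattice E] (f : ℕ → E) : Prop :=
  ∃ p : E, 0 < p ∧ ∀ ε : ℝ, 0 < ε → ∃ N : ℕ, ∀ m ≥ N, ∀ n ≥ N, |f m - f n| < ε • p

/-- Every relatively uniformly Cauchy sequence converges relatively uniformly. -/
def UniformlyComplete (E : Type*) [AddCommGroup E] [Module ℝ E] [Lattice E] : Prop :=
  ∀ f : ℕ → E, RUCauchy f → ∃ g : E, RUConverges f g

universe u v

/-- `(Eu, φ)` is a uniform completion of `E`: `Eu` is uniformly complete, `φ` is an injective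
vector lattice homomorphism, and every vector lattice homomorphism from `E` to a uniformly complete
Archimedean vector lattice `F` factors uniquely through `φ`. The test spaces `F` range over the
universe of `Eu`; in particular, the uniformly complete vector sublattices of `Eu` are among them. -/
structure IsUniformCompletion {E : Type u} {Eu : Type v}
    [AddCommGroup E] [Module ℝ E] [Lattice E]
    [AddCommGroup Eu] [Module ℝ Eu] [Lattice Eu] [IsArchimedeanVectorLattice Eu]
    (φ : VectorLatticeHom E Eu) : Prop where
  uniformlyComplete : UniformlyComplete Eu
  injective : Function.Injective φ
  existsUnique_lift : ∀ (F : Type v) [AddCommGroup F] [Module ℝ F] [Lattice F]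
    [IsArchimedeanVectorLattice F], UniformlyComplete F →
    ∀ T : VectorLatticeHom E F, ∃! Tu : VectorLatticeHom Eu F, ∀ x : E, Tu (φ x) = T x

/-- The space `ℋ(ℝ^m)` of continuous positively homogeneous real functions on `ℝ^m`. -/
structure PosHomFun (m : ℕ) where
  toFun : (Fin m → ℝ) → ℝ
  continuous' : Continuous toFun
  map_smul' : ∀ (r : ℝ), 0 ≤ r → ∀ x : Fin m → ℝ, toFun (r • x) = r * toFun x

section FunctionalCalculus

variable {E : Type*} [AddCommGroup E] [Module ℝ E] [Lattice E]

/-- `h(a₁, …, a_m) = b` in `E`: one has `h(ω(a₁), …, ω(a_m)) = ω(b)` for every nonzero real-valued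
vector lattice homomorphism `ω` on the vector sublattice generated by `a₁, …, a_m, b`. -/
def IsFunctionalValue {m : ℕ} (h : PosHomFun m) (a : Fin m → E) (b : E) : Prop :=
  ∀ ω : VectorLatticeHom (VectorSublattice.generated (Set.range a ∪ {b})) ℝ, (∃ x, ω x ≠ 0) →
    h.toFun (fun i => ω ⟨a i, VectorSublattice.subset_generated _ (Or.inl ⟨i, rfl⟩)⟩) =
      ω ⟨b, VectorSublattice.subset_generated _ (Or.inr rfl)⟩

/-- The vector sublattice generated by `L` and all elements `h(a₁, …, a_m)` with `h ∈ D` and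
`a₁, …, a_m ∈ L`. -/
def functionalStep (D : Set (Σ m : ℕ+, PosHomFun m)) (L : VectorSublattice E) :
    VectorSublattice E :=
  VectorSublattice.generated (L.carrier ∪
    {b | ∃ h ∈ D, ∃ a : Fin h.1 → E, (∀ i, a i ∈ L.carrier) ∧ IsFunctionalValue h.2 a b})

theorem le_functionalStep (D : Set (Σ m : ℕ+, PosHomFun m)) (L : VectorSublattice E) :
    L.carrier ⊆ (functionalStep D L).carrier :=
  fun _ hx => VectorSublattice.subset_generated _ (Or.inl hx)

variable {Eu : Type*} [AddCommGroup Eu] [Module ℝ Eu] [Lattice Eu]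

/-- The increasing sequence of vector sublattices that starts with `φ(E)` and proceeds by
`functionalStep D`. -/
def functionalStage (D : Set (Σ m : ℕ+, PosHomFun m)) (φ : VectorLatticeHom E Eu) :
    ℕ → VectorSublattice Eu
  | 0 => VectorSublattice.range φ
  | n + 1 => functionalStep D (functionalStage D φ n)

theorem functionalStage_mono (D : Set (Σ m : ℕ+, PosHomFun m)) (φ : VectorLatticeHom E Eu) :
    Monotone (fun n => (functionalStage D φ n).carrier) :=
  monotone_nat_of_le_succ (fun _ => le_functionalStep D _)

/-- The space `E^D`, the union of the stages above; here `(Eu, φ)` is meant to be the uniform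
completion of `E`. -/
def functionalCompletion (D : Set (Σ m : ℕ+, PosHomFun m)) (φ : VectorLatticeHom E Eu) :
    VectorSublattice Eu where
  carrier := ⋃ n, (functionalStage D φ n).carrier
  zero_mem' := Set.mem_iUnion.2 ⟨0, (functionalStage D φ 0).zero_mem'⟩
  add_mem' := by
    intro x y hx hy
    obtain ⟨i, hi⟩ := Set.mem_iUnion.1 hx
    obtain ⟨j, hj⟩ := Set.mem_iUnion.1 hy
    exact Set.mem_iUnion.2 ⟨max i j, (functionalStage D φ (max i j)).add_mem'
      (functionalStage_mono D φ (le_max_left i j) hi)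
      (functionalStage_mono D φ (le_max_right i j) hj)⟩
  smul_mem' := by
    intro c x hx
    obtain ⟨i, hi⟩ := Set.mem_iUnion.1 hx
    exact Set.mem_iUnion.2 ⟨i, (functionalStage D φ i).smul_mem' c hi⟩
  sup_mem' := by
    intro x y hx hy
    obtain ⟨i, hi⟩ := Set.mem_iUnion.1 hx
    obtain ⟨j, hj⟩ := Set.mem_iUnion.1 hy
    exact Set.mem_iUnion.2 ⟨max i j, (functionalStage D φ (max i j)).sup_mem'
      (functionalStage_mono D φ (le_max_left i j) hi)
      (functionalStage_mono D φ (le_max_right i j) hj)⟩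
  inf_mem' := by
    intro x y hx hy
    obtain ⟨i, hi⟩ := Set.mem_iUnion.1 hx
    obtain ⟨j, hj⟩ := Set.mem_iUnion.1 hy
    exact Set.mem_iUnion.2 ⟨max i j, (functionalStage D φ (max i j)).inf_mem'
      (functionalStage_mono D φ (le_max_left i j) hi)
      (functionalStage_mono D φ (le_max_right i j) hj)⟩

/-- `φ`, considered as a vector lattice homomorphism from `E` to `E^D`. -/
def functionalEmbedding (D : Set (Σ m : ℕ+, PosHomFun m)) (φ : VectorLatticeHom E Eu) :
    VectorLatticeHom E (functionalCompletion D φ) where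
  toLinearMap := LinearMap.codRestrict (functionalCompletion D φ).toSubmodule φ.toLinearMap
    (fun x => Set.mem_iUnion.2 ⟨0, x, rfl⟩)
  map_sup' := fun x y => Subtype.ext (φ.map_sup' x y)
  map_inf' := fun x y => Subtype.ext (φ.map_inf' x y)

end FunctionalCalculus

/-- An `s`-linear map is positive if it is nonnegative whenever all its arguments are. -/
def MultilinearMap.IsPositive {ι : Type*} {E : ι → Type*} {F : Type*}
    [∀ k, AddCommGroup (E k)] [∀ k, Module ℝ (E k)] [∀ k, Lattice (E k)]
    [AddCommGroup F] [Module ℝ F] [Lattice F] (T : MultilinearMap ℝ E F) : Prop :=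
  ∀ f : ∀ k, E k, (∀ k, 0 ≤ f k) → 0 ≤ T f

/-! A positive multilinear `T` satisfies `|T f| ≤ T p` whenever `|f k| ≤ p k` for all `k`, so it is
Lipschitz with respect to regulators. If every point of a larger lattice is a relatively uniform
limit of points of the smaller one, with regulators from the smaller one, then the values of `T` at
approximants are relatively uniformly Cauchy. Their limits in the uniformly complete space `F`
define the extension. Any positive extension obeys the same Lipschitz estimate, hence has these
values (`MultilinearMap.IsPositive.existsUnique_extension`).

It remains to see that `φ(E)` is dense in `E^D` in this sense
(`hasRUDenseRange_functionalEmbedding`). The limits in question form a vector sublattice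
(`ruClosure`), so only closure under functional values `b = h(a)` needs an idea. By the lattice form
of Stone–Weierstrass on the `ℓ¹` sphere, `h` differs from some lattice-linear expression `g` by at
most `ε ∑ |x i|`. The sublattice generated by the `a i` and `b` has the order unit `∑ |a i| + |b|`,
so its real homomorphisms determine its order (`nonneg_of_forall_hom_nonneg`, by a Hahn–Banach
argument). Hence `|b - g(a)| ≤ ε ∑ |a i|`. As `g` is Lipschitz and commutes with homomorphisms,
approximations of the `a i` yield approximations of `b`. -/

namespace VectorLatticeHom

variable {E F : Type*} [AddCommGroup E] [Module ℝ E] [Lattice E]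
  [AddCommGroup F] [Module ℝ F] [Lattice F]

theorem map_sup (T : VectorLatticeHom E F) (x y : E) : T (x ⊔ y) = T x ⊔ T y :=
  T.map_sup' x y

theorem map_abs (T : VectorLatticeHom E F) (x : E) : T |x| = |T x| := by
  rw [abs, T.map_sup, map_neg, abs]

theorem map_le_map_iff (T : VectorLatticeHom E F) (hT : Function.Injective T) {x y : E} :
    T x ≤ T y ↔ x ≤ y := by
  rw [← sup_eq_right, ← T.map_sup, hT.eq_iff, sup_eq_right]

theorem map_le_map (T : VectorLatticeHom E F) {x y : E} (h : x ≤ y) : T x ≤ T y := by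
  rw [← sup_eq_right] at h ⊢
  rw [← T.map_sup, h]

end VectorLatticeHom

/-! ### Inequalities and relatively uniform limits in Archimedean vector lattices. -/

section VectorLattice

variable {E : Type*} [AddCommGroup E] [Module ℝ E] [Lattice E] [IsArchimedeanVectorLattice E]

theorem lattice_abs_sub_le (a b c : E) : |a - c| ≤ |a - b| + |b - c| := by
  simpa using abs_add_le (a - b) (b - c)

theorem lattice_abs_sub_le_add (a b : E) : |a - b| ≤ |a| + |b| := by
  simpa [sub_eq_add_neg] using abs_add_le a (-b)

theorem lattice_abs_sup_sub_sup_le (a b c d : E) : |a ⊔ b - c ⊔ d| ≤ |a - c| + |b - d| := by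
  refine (lattice_abs_sub_le _ (c ⊔ b) _).trans
    (add_le_add (abs_sup_sub_sup_le_abs a c b) ?_)
  rw [sup_comm c b, sup_comm c d]
  exact abs_sup_sub_sup_le_abs b d c

theorem lattice_abs_inf_sub_inf_le (a b c d : E) : |a ⊓ b - c ⊓ d| ≤ |a - c| + |b - d| := by
  refine (lattice_abs_sub_le _ (c ⊓ b) _).trans
    (add_le_add (abs_inf_sub_inf_le_abs a c b) ?_)
  rw [inf_comm c b, inf_comm c d]
  exact abs_inf_sub_inf_le_abs b d c

theorem lattice_abs_smul {r : ℝ} (hr : 0 ≤ r) (x : E) : |r • x| = r • |x| := by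
  rcases hr.eq_or_lt with rfl | hr
  · simp
  · have := (OrderIso.smulRight (β := E) hr).map_sup x (-x)
    simp only [OrderIso.smulRight_apply, smul_neg] at this
    exact this.symm

theorem lattice_abs_smul_le (r : ℝ) (x : E) : |r • x| ≤ |r| • |x| := by
  rcases le_total 0 r with hr | hr
  · rw [lattice_abs_smul hr, abs_of_nonneg hr]
  · rw [← abs_neg, ← neg_smul, lattice_abs_smul (neg_nonneg.2 hr), abs_of_nonpos hr]

/-- The Archimedean axiom for `x⁺` and `|q|`, using only `ε = 1 / (n + 1)`. No sign is required of
`q`, so regulators can be combined freely in later estimates. -/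
theorem nonpos_of_forall_le_smul {x q : E} (h : ∀ ε : ℝ, 0 < ε → ε ≤ 1 → x ≤ ε • q) : x ≤ 0 := by
  rw [← posPart_eq_zero]
  refine IsArchimedeanVectorLattice.eq_zero_of_nsmul_le _ |q| (posPart_nonneg x) fun n => ?_
  have hn : (0 : ℝ) < n + 1 := by positivity
  have h1 : x⁺ ≤ (1 / ((n : ℝ) + 1)) • |q| := by
    refine sup_le ((h (1 / ((n : ℝ) + 1)) (by positivity) ?_).trans ?_) ?_
    · rw [div_le_one hn]; simp
    · exact smul_le_smul_of_nonneg_left (le_abs_self q) (by positivity)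
    · exact smul_nonneg (by positivity) (abs_nonneg q)
  have h2 : ((n : ℝ) + 1) • x⁺ ≤ |q| := by
    have := smul_le_smul_of_nonneg_left h1 hn.le
    rwa [smul_smul, mul_one_div_cancel hn.ne', one_smul] at this
  rw [add_smul, one_smul, Nat.cast_smul_eq_nsmul] at h2
  exact (le_add_of_nonneg_right (posPart_nonneg x)).trans h2

theorem eq_of_forall_abs_sub_le_smul {x y q : E}
    (h : ∀ ε : ℝ, 0 < ε → ε ≤ 1 → |x - y| ≤ ε • q) : x = y := by
  have := abs_le'.1 (nonpos_of_forall_le_smul h)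
  refine le_antisymm (by simpa using this.1) (by simpa using this.2)

/-- In the definition of uniform completeness, strict inequalities and nonzero regulators may be
replaced by weak inequalities and arbitrary regulators. -/
theorem UniformlyComplete.exists_limit (hE : UniformlyComplete E) {f : ℕ → E} {p : E}
    (hf : ∀ ε : ℝ, 0 < ε → ∃ N : ℕ, ∀ m ≥ N, ∀ n ≥ N, |f m - f n| ≤ ε • p) :
    ∃ g q : E, ∀ ε : ℝ, 0 < ε → ∃ N : ℕ, ∀ n ≥ N, |f n - g| ≤ ε • q := by
  have hp : 0 ≤ p := by
    obtain ⟨N, hN⟩ := hf 1 one_pos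
    simpa using hN N le_rfl N le_rfl
  -- The regulator `0` is not admitted in `RUCauchy`, but with it the sequence is eventually
  -- constant.
  rcases hp.eq_or_lt with rfl | hp
  · obtain ⟨N, hN⟩ := hf 1 one_pos
    refine ⟨f N, 0, fun ε _ => ⟨N, fun n hn => ?_⟩⟩
    simpa using hN n hn N le_rfl
  · obtain ⟨g, q, -, hq⟩ := hE f ⟨p, hp, fun ε hε => by
      obtain ⟨N, hN⟩ := hf (ε / 2) (by positivity)
      -- Halving `ε` makes the weak inequality strict, since `p ≠ 0`.
      refine ⟨N, fun m hm n hn => (hN m hm n hn).trans_lt ?_⟩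
      rw [← sub_pos, ← sub_smul]
      exact lt_of_le_of_ne (smul_nonneg (by linarith) hp.le)
        (smul_ne_zero (by linarith) hp.ne').symm⟩
    refine ⟨g, q, fun ε hε => ?_⟩
    obtain ⟨N, hN⟩ := hq ε hε
    exact ⟨N, fun n hn => (hN n hn).le⟩

end VectorLattice

/-! ### Domination and Lipschitz estimates for positive multilinear maps. -/

section PositiveMultilinear

variable {ι : Type*} [DecidableEq ι] {A B : ι → Type*}
  [∀ k, AddCommGroup (A k)] [∀ k, Module ℝ (A k)] [∀ k, Lattice (A k)]
  [∀ k, IsArchimedeanVectorLattice (A k)]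
  [∀ k, AddCommGroup (B k)] [∀ k, Module ℝ (B k)] [∀ k, Lattice (B k)]
  [∀ k, IsArchimedeanVectorLattice (B k)]
  {F : Type*} [AddCommGroup F] [Module ℝ F] [Lattice F] [IsArchimedeanVectorLattice F]

namespace MultilinearMap.IsPositive

variable {T : MultilinearMap ℝ A F}

theorem update_le_update (hT : T.IsPositive) {f : ∀ k, A k} (hf : ∀ k, 0 ≤ f k) (i : ι)
    {x y : A i} (h : x ≤ y) : T (Function.update f i x) ≤ T (Function.update f i y) := by
  rw [← sub_nonneg, ← T.map_update_sub]
  refine hT _ fun k => ?_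
  by_cases hk : k = i
  · subst hk; simpa using h
  · simpa [hk] using hf k

/-- Induction over the coordinates of unknown sign: splitting `f i` into `(f i)⁺` and `(f i)⁻` gives
two terms whose bounds add up to the value at `|f i|`, which is at most the value at `p i` by
monotonicity. -/
theorem abs_apply_le_piecewise (hT : T.IsPositive) {p : ∀ k, A k} (hp : ∀ k, 0 ≤ p k)
    (S : Finset ι) : ∀ f : ∀ k, A k, (∀ k ∈ S, |f k| ≤ p k) → (∀ k ∉ S, 0 ≤ f k) →
      |T f| ≤ T (S.piecewise p f) := by
  induction S using Finset.induction_on with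
  | empty =>
    intro f _ h
    rw [abs_of_nonneg (hT f fun k => h k (by simp)), Finset.piecewise_empty]
  | insert i S hi ih =>
    intro f h1 h2
    have key : ∀ c : A i, 0 ≤ c → |T (Function.update f i c)| ≤
        T (Function.update (S.piecewise p f) i c) := by
      intro c hc
      have := ih (Function.update f i c) (fun k hk => ?_) (fun k hk => ?_)
      · rwa [show S.piecewise p (Function.update f i c) =
          Function.update (S.piecewise p f) i c from ?_] at this
        ext k
        by_cases hk : k = i
        · subst hk; simp [hi]
        · by_cases hkS : k ∈ S <;> simp [hk, hkS]
      · rw [Function.update_of_ne (fun e => hi (by rwa [e] at hk))]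
        exact h1 k (Finset.mem_insert_of_mem hk)
      · by_cases hki : k = i
        · subst hki; simpa using hc
        · rw [Function.update_of_ne hki]
          exact h2 k (by simp [hki, hk])
    have e : T f = T (Function.update f i (f i)⁺) - T (Function.update f i (f i)⁻) := by
      rw [← T.map_update_sub, posPart_sub_negPart, Function.update_eq_self]
    calc |T f| ≤ _ := e ▸ lattice_abs_sub_le_add _ _
      _ ≤ _ := add_le_add (key _ (posPart_nonneg _)) (key _ (negPart_nonneg _))
      _ = T (Function.update (S.piecewise p f) i |f i|) := by
        rw [← T.map_update_add, posPart_add_negPart]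
      _ = T (Function.update (Function.update (S.piecewise p f) i |f i|) i |f i|) := by simp
      _ ≤ T (Function.update (Function.update (S.piecewise p f) i |f i|) i (p i)) := by
        refine hT.update_le_update (fun k => ?_) i (h1 i (Finset.mem_insert_self i S))
        by_cases hki : k = i
        · subst hki; simp
        · by_cases hkS : k ∈ S
          · simp [hki, hkS, hp]
          · simpa [hki, hkS] using h2 k (by simp [hki, hkS])
      _ = _ := by rw [Finset.piecewise_insert, Function.update_idem]

theorem abs_apply_le [Fintype ι] (hT : T.IsPositive) {f p : ∀ k, A k} (h : ∀ k, |f k| ≤ p k) :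
    |T f| ≤ T p := by
  simpa using hT.abs_apply_le_piecewise (fun k => (abs_nonneg _).trans (h k)) Finset.univ f
    (fun k _ => h k) (fun k hk => absurd (Finset.mem_univ k) hk)

/-- Positive multilinear maps are Lipschitz on order intervals with respect to the regulator. -/
theorem abs_sub_le [Fintype ι] (hT : T.IsPositive) {f g p : ∀ k, A k} {ε : ℝ} (hf : ∀ k, |f k| ≤ p k)
    (hg : ∀ k, |g k| ≤ p k) (hfg : ∀ k, |f k - g k| ≤ ε • p k) :
    |T f - T g| ≤ (Fintype.card ι * ε) • T p := by
  -- Replace `g` by `f` one coordinate at a time; each exchange costs at most `ε • T p`.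
  suffices h : ∀ S : Finset ι, |T (S.piecewise f g) - T g| ≤ (S.card * ε) • T p by
    simpa using h Finset.univ
  intro S
  induction S using Finset.induction_on with
  | empty => simp
  | insert i S hi ih =>
    have e : T ((insert i S).piecewise f g) - T (S.piecewise f g) =
        T (Function.update (S.piecewise f g) i (f i - g i)) := by
      rw [T.map_update_sub, Finset.piecewise_insert]
      congr 2
      rw [Function.eq_update_iff]
      simp [hi]
    refine (lattice_abs_sub_le _ (T (S.piecewise f g)) _).trans ?_
    rw [Finset.card_insert_of_notMem hi, Nat.cast_add, Nat.cast_one, add_mul, one_mul, add_smul,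
      add_comm, e]
    refine add_le_add ih ?_
    refine (hT.abs_apply_le (p := Function.update p i (ε • p i)) fun k => ?_).trans_eq ?_
    · by_cases hk : k = i
      · subst hk; simpa using hfg k
      · by_cases hkS : k ∈ S <;> simp [hk, hkS, hf, hg]
    · rw [T.map_update_smul, Function.update_eq_self]

end MultilinearMap.IsPositive

end PositiveMultilinear

/-! ### Relatively uniform approximation from the range of a homomorphism. -/

namespace VectorLatticeHom

/-- `x` is a relatively uniform limit of elements of the range of `j`, with a regulator in the
range. -/
def IsRULimit {A B : Type*} [AddCommGroup A] [Module ℝ A] [Lattice A]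
    [AddCommGroup B] [Module ℝ B] [Lattice B] (j : VectorLatticeHom A B) (x : B) : Prop :=
  ∃ p : A, ∀ ε : ℝ, 0 < ε → ∃ a : A, |x - j a| ≤ ε • j p

/-- Every element of the codomain is a relatively uniform limit of elements of the range. -/
def HasRUDenseRange {A B : Type*} [AddCommGroup A] [Module ℝ A] [Lattice A]
    [AddCommGroup B] [Module ℝ B] [Lattice B] (j : VectorLatticeHom A B) : Prop :=
  ∀ x : B, j.IsRULimit x

variable {A B : Type*} [AddCommGroup A] [Module ℝ A] [Lattice A]
  [AddCommGroup B] [Module ℝ B] [Lattice B] [IsArchimedeanVectorLattice B]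

theorem IsRULimit.exists_regulator [IsArchimedeanVectorLattice A]
    {j : VectorLatticeHom A B} {x : B} (hx : j.IsRULimit x) :
    ∃ p : A, 0 ≤ p ∧ ∀ ε : ℝ, 0 < ε → ∃ a : A, |x - j a| ≤ ε • j p := by
  obtain ⟨p, hp⟩ := hx
  refine ⟨|p|, abs_nonneg p, fun ε hε => ?_⟩
  obtain ⟨a, ha⟩ := hp ε hε
  exact ⟨a, ha.trans (smul_le_smul_of_nonneg_left (j.map_le_map (le_abs_self p)) hε.le)⟩

theorem IsRULimit.exists_abs_le [IsArchimedeanVectorLattice A]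
    {j : VectorLatticeHom A B} {x : B} (hx : j.IsRULimit x) : ∃ p : A, 0 ≤ p ∧ |x| ≤ j p := by
  obtain ⟨p, hp, h⟩ := hx.exists_regulator
  obtain ⟨a, ha⟩ := h 1 one_pos
  refine ⟨p + |a|, add_nonneg hp (abs_nonneg a), ?_⟩
  rw [map_add, j.map_abs]
  calc |x| = |(x - j a) + j a| := by simp
    _ ≤ |x - j a| + |j a| := abs_add_le _ _
    _ ≤ _ := by simpa using ha

end VectorLatticeHom

/-! ### Extension of positive multilinear maps along dense embeddings. -/

section Extension

set_option linter.unusedSectionVars false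

variable {ι : Type*} [DecidableEq ι] {A B : ι → Type*}
  [∀ k, AddCommGroup (A k)] [∀ k, Module ℝ (A k)] [∀ k, Lattice (A k)]
  [∀ k, IsArchimedeanVectorLattice (A k)]
  [∀ k, AddCommGroup (B k)] [∀ k, Module ℝ (B k)] [∀ k, Lattice (B k)]
  [∀ k, IsArchimedeanVectorLattice (B k)]
  {F : Type*} [AddCommGroup F] [Module ℝ F] [Lattice F] [IsArchimedeanVectorLattice F]
  {j : ∀ k, VectorLatticeHom (A k) (B k)} {T : MultilinearMap ℝ A F}

namespace MultilinearMap

/-- `y` is the limit of the values `T a` as `j a` approaches `x` relatively uniformly; the rate of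
convergence depends only on the regulator. -/
def IsLimitValue (j : ∀ k, VectorLatticeHom (A k) (B k)) (T : MultilinearMap ℝ A F)
    (x : ∀ k, B k) (y : F) : Prop :=
  ∀ P : ∀ k, A k, (∀ k, 0 ≤ P k) → ∃ q : F, ∀ ε : ℝ, 0 < ε → ε ≤ 1 → ∀ a : ∀ k, A k,
    (∀ k, |x k - j k (a k)| ≤ ε • j k (P k)) → |y - T a| ≤ ε • q

/-- Two `ε`-approximants of `x` differ by at most `2ε • P`, and `ε ≤ 1` bounds both by `Q + P`
independently of `ε`. Injectivity of `j k` is what carries these inequalities from `B k` back to `A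
k`, where `T` is defined. -/
theorem IsPositive.abs_sub_le_of_approx [Fintype ι] (hT : T.IsPositive)
    (hj : ∀ k, Function.Injective (j k)) {x : ∀ k, B k} {Q P a a' : ∀ k, A k}
    (hQ : ∀ k, |x k| ≤ j k (Q k)) (hP : ∀ k, 0 ≤ P k) {ε : ℝ} (hε : 0 < ε) (hε1 : ε ≤ 1)
    (ha : ∀ k, |x k - j k (a k)| ≤ ε • j k (P k))
    (ha' : ∀ k, |x k - j k (a' k)| ≤ ε • j k (P k)) :
    |T a - T a'| ≤ ε • ((Fintype.card ι * 2 : ℝ) • T (fun k => Q k + P k)) := by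
  have hjP : ∀ k, 0 ≤ j k (P k) := fun k => by simpa using (j k).map_le_map (hP k)
  have bound : ∀ b : ∀ k, A k, (∀ k, |x k - j k (b k)| ≤ ε • j k (P k)) →
      ∀ k, |b k| ≤ Q k + P k := by
    intro b hb k
    rw [← (j k).map_le_map_iff (hj k), map_add, (j k).map_abs]
    calc |j k (b k)| = |x k - (x k - j k (b k))| := by simp
      _ ≤ |x k| + |x k - j k (b k)| := lattice_abs_sub_le_add _ _
      _ ≤ _ := add_le_add (hQ k) ((hb k).trans (smul_le_of_le_one_left (hjP k) hε1))
  have hQ0 : ∀ k, 0 ≤ Q k := fun k => by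
    rw [← (j k).map_le_map_iff (hj k), LinearMap.map_zero]
    exact (abs_nonneg _).trans (hQ k)
  refine (hT.abs_sub_le (ε := 2 * ε) (bound a ha) (bound a' ha') fun k => ?_).trans_eq ?_
  · rw [← (j k).map_le_map_iff (hj k), (j k).map_abs, map_sub, map_smul, map_add]
    calc |j k (a k) - j k (a' k)| ≤ |j k (a k) - x k| + |x k - j k (a' k)| :=
          lattice_abs_sub_le _ _ _
      _ ≤ ε • j k (P k) + ε • j k (P k) := add_le_add (by rw [abs_sub_comm]; exact ha k) (ha' k)
      _ = (2 * ε) • j k (P k) := by module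
      _ ≤ _ := by
        refine smul_le_smul_of_nonneg_left (le_add_of_nonneg_left ?_) (by positivity)
        simpa using (j k).map_le_map (hQ0 k)
  · rw [smul_smul]; congr 1; ring

/-- One sequence of approximants, with fixed regulators `R`, produces `y`. An arbitrary approximant
with regulators `P` is then compared with a late term of that sequence through the common regulators
`P + R`. -/
theorem IsPositive.exists_isLimitValue [Fintype ι] (hT : T.IsPositive)
    (hj : ∀ k, Function.Injective (j k)) (hd : ∀ k, (j k).HasRUDenseRange)
    (hF : UniformlyComplete F) (x : ∀ k, B k) : ∃ y, IsLimitValue j T x y := by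
  choose Q hQ0 hQ using fun k => (hd k (x k)).exists_abs_le
  choose R hR0 hR using fun k => (hd k (x k)).exists_regulator
  choose a ha using fun n : ℕ => fun k => hR k (1 / ((n : ℝ) + 1)) (by positivity)
  have small : ∀ ε : ℝ, 0 < ε → ∃ N : ℕ, ∀ n ≥ N, 1 / ((n : ℝ) + 1) ≤ ε := by
    intro ε hε
    obtain ⟨N, hN⟩ := exists_nat_one_div_lt hε
    refine ⟨N, fun n hn => le_trans ?_ hN.le⟩
    exact one_div_le_one_div_of_le (by positivity) (by exact_mod_cast Nat.succ_le_succ hn)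
  have hjR : ∀ k, 0 ≤ j k (R k) := fun k => by simpa using (j k).map_le_map (hR0 k)
  have near : ∀ ε : ℝ, 0 < ε → ∃ N : ℕ, ∀ n ≥ N, ∀ k, |x k - j k (a n k)| ≤ ε • j k (R k) := by
    intro ε hε
    obtain ⟨N, hN⟩ := small ε hε
    exact ⟨N, fun n hn k => (ha n k).trans (smul_le_smul_of_nonneg_right (hN n hn) (hjR k))⟩
  obtain ⟨y, q₀, hy⟩ := hF.exists_limit (f := fun n => T (a n))
    (p := (Fintype.card ι * 2 : ℝ) • T (fun k => Q k + R k)) fun ε hε => by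
      obtain ⟨N, hN⟩ := near (min ε 1) (by positivity)
      refine ⟨N, fun m hm n hn => (hT.abs_sub_le_of_approx hj hQ hR0 (by positivity)
        (min_le_right _ _) (hN m hm) (hN n hn)).trans ?_⟩
      refine smul_le_smul_of_nonneg_right (min_le_left _ _) (smul_nonneg (by positivity) ?_)
      exact hT _ fun k => add_nonneg (hQ0 k) (hR0 k)
  refine ⟨y, fun P hP => ⟨q₀ + (Fintype.card ι * 2 : ℝ) • T (fun k => Q k + (P k + R k)),
    fun ε hε hε1 b hb => ?_⟩⟩
  obtain ⟨N, hN⟩ := near ε hε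
  obtain ⟨M, hM⟩ := hy ε hε
  have hjP : ∀ k, 0 ≤ j k (P k) := fun k => by simpa using (j k).map_le_map (hP k)
  have h1 := hM (max N M) (le_max_right _ _)
  have h2 := hT.abs_sub_le_of_approx (a := a (max N M)) (a' := b) (P := fun k => P k + R k) hj hQ
    (fun k => add_nonneg (hP k) (hR0 k)) hε hε1
    (fun k => (hN _ (le_max_left _ _) k).trans (smul_le_smul_of_nonneg_left
      (by rw [map_add]; exact le_add_of_nonneg_left (hjP k)) hε.le))
    (fun k => (hb k).trans (smul_le_smul_of_nonneg_left
      (by rw [map_add]; exact le_add_of_nonneg_right (hjR k)) hε.le))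
  rw [smul_add]
  refine (lattice_abs_sub_le _ (T (a (max N M))) _).trans (add_le_add ?_ h2)
  rwa [abs_sub_comm]

/-- Approximations in all coordinates with a common bound on the regulators. -/
theorem exists_approx (hd : ∀ k, (j k).HasRUDenseRange) (x : ∀ k, B k) :
    ∃ P : ∀ k, A k, (∀ k, 0 ≤ P k) ∧ ∀ ε : ℝ, 0 < ε →
      ∃ a : ∀ k, A k, ∀ k, |x k - j k (a k)| ≤ ε • j k (P k) := by
  choose P hP0 hP using fun k => (hd k (x k)).exists_regulator
  refine ⟨P, hP0, fun ε hε => ?_⟩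
  choose a ha using fun k => hP k ε hε
  exact ⟨a, ha⟩

theorem IsLimitValue.apply_eq (j : ∀ k, VectorLatticeHom (A k) (B k)) {a : ∀ k, A k} {y : F}
    (h : IsLimitValue j T (fun k => j k (a k)) y) : y = T a := by
  obtain ⟨q, hq⟩ := h 0 fun _ => le_rfl
  exact eq_of_forall_abs_sub_le_smul fun ε hε hε1 => hq ε hε hε1 a fun k => by simp

theorem IsLimitValue.nonneg (hT : T.IsPositive) (hd : ∀ k, (j k).HasRUDenseRange)
    {x : ∀ k, B k} (hx : ∀ k, 0 ≤ x k) {y : F} (h : IsLimitValue j T x y) : 0 ≤ y := by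
  obtain ⟨P, hP0, hP⟩ := exists_approx hd x
  obtain ⟨q, hq⟩ := h P hP0
  rw [← neg_nonpos]
  refine nonpos_of_forall_le_smul (q := q) fun ε hε hε1 => ?_
  obtain ⟨a, ha⟩ := hP ε hε
  -- Truncation at `0` keeps the approximation, as `x k ≥ 0`, and makes the value of `T`
  -- nonnegative.
  have h1 := hq ε hε hε1 (fun k => a k ⊔ 0) fun k => by
    rw [(j k).map_sup, LinearMap.map_zero]
    calc _ = |x k ⊔ 0 - j k (a k) ⊔ 0| := by rw [sup_eq_left.2 (hx k)]
      _ ≤ _ := (abs_sup_sub_sup_le_abs _ _ _).trans (ha k)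
  have h2 : 0 ≤ T (fun k => a k ⊔ 0) := hT _ fun k => le_sup_right
  calc -y ≤ -y + T (fun k => a k ⊔ 0) := le_add_of_nonneg_right h2
    _ = -(y - T (fun k => a k ⊔ 0)) := by abel
    _ ≤ _ := (neg_le_abs _).trans h1

theorem abs_update_sub_le {x : ∀ k, B k} {a P : ∀ k, A k} {ε : ℝ} {i : ι} {u : B i} {c p : A i}
    (h : ∀ k, |x k - j k (a k)| ≤ ε • j k (P k)) (hc : |u - j i c| ≤ ε • j i p) (k : ι) :
    |Function.update x i u k - j k (Function.update a i c k)| ≤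
      ε • j k (Function.update P i p k) := by
  by_cases hk : k = i
  · subst hk; simpa using hc
  · simpa [hk] using h k

theorem update_nonneg {P : ∀ k, A k} (h : ∀ k, 0 ≤ P k) {i : ι} {p : A i} (hp : 0 ≤ p) (k : ι) :
    0 ≤ Function.update P i p k := by
  by_cases hk : k = i
  · subst hk; simpa using hp
  · simpa [hk] using h k

/-- If `c` and `d` approximate `u` and `v`, then `c + d` approximates `u + v` with the sum of the
regulators; additivity of `T` passes to the limit. -/
theorem IsLimitValue.update_add (hd : ∀ k, (j k).HasRUDenseRange) {x : ∀ k, B k} {i : ι}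
    {u v : B i} {y z w : F} (hu : IsLimitValue j T (Function.update x i u) y)
    (hv : IsLimitValue j T (Function.update x i v) z)
    (huv : IsLimitValue j T (Function.update x i (u + v)) w) : w = y + z := by
  obtain ⟨P, hP0, hP⟩ := exists_approx hd x
  obtain ⟨p, hp0, hp⟩ := (hd i u).exists_regulator
  obtain ⟨p', hp0', hp'⟩ := (hd i v).exists_regulator
  obtain ⟨q₁, h₁⟩ := hu _ (update_nonneg hP0 hp0)
  obtain ⟨q₂, h₂⟩ := hv _ (update_nonneg hP0 hp0')
  obtain ⟨q₃, h₃⟩ := huv _ (update_nonneg hP0 (add_nonneg hp0 hp0'))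
  refine eq_of_forall_abs_sub_le_smul (q := q₃ + (q₁ + q₂)) fun ε hε hε1 => ?_
  obtain ⟨a, ha⟩ := hP ε hε
  obtain ⟨c, hc⟩ := hp ε hε
  obtain ⟨d, hd⟩ := hp' ε hε
  have e₁ := h₁ ε hε hε1 _ (abs_update_sub_le ha hc)
  have e₂ := h₂ ε hε hε1 _ (abs_update_sub_le ha hd)
  have e₃ := h₃ ε hε hε1 _ (abs_update_sub_le (c := c + d) ha (by
    rw [map_add, map_add, smul_add, add_sub_add_comm]
    exact (abs_add_le _ _).trans (add_le_add hc hd)))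
  rw [T.map_update_add] at e₃
  rw [show w - (y + z) = (w - (T (Function.update a i c) + T (Function.update a i d))) -
    ((y - T (Function.update a i c)) + (z - T (Function.update a i d))) by abel,
    smul_add, smul_add]
  exact (lattice_abs_sub_le_add _ _).trans
    (add_le_add e₃ ((abs_add_le _ _).trans (add_le_add e₁ e₂)))

theorem IsLimitValue.update_smul (hd : ∀ k, (j k).HasRUDenseRange) {x : ∀ k, B k} {i : ι}
    {u : B i} {r : ℝ} {y w : F} (hu : IsLimitValue j T (Function.update x i u) y)
    (hru : IsLimitValue j T (Function.update x i (r • u)) w) : w = r • y := by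
  obtain ⟨P, hP0, hP⟩ := exists_approx hd x
  obtain ⟨p, hp0, hp⟩ := (hd i u).exists_regulator
  obtain ⟨q₁, h₁⟩ := hu _ (update_nonneg hP0 hp0)
  obtain ⟨q₂, h₂⟩ := hru _ (update_nonneg hP0 (smul_nonneg (abs_nonneg r) hp0))
  refine eq_of_forall_abs_sub_le_smul (q := q₂ + |r| • q₁) fun ε hε hε1 => ?_
  obtain ⟨a, ha⟩ := hP ε hε
  obtain ⟨c, hc⟩ := hp ε hε
  have e₁ := h₁ ε hε hε1 _ (abs_update_sub_le ha hc)
  have e₂ := h₂ ε hε hε1 _ (abs_update_sub_le (c := r • c) ha (by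
    rw [map_smul, map_smul, ← smul_sub, smul_comm]
    exact (lattice_abs_smul_le _ _).trans (smul_le_smul_of_nonneg_left hc (abs_nonneg r))))
  rw [T.map_update_smul] at e₂
  rw [show w - r • y = (w - r • T (Function.update a i c)) -
    r • (y - T (Function.update a i c)) by module, smul_add, smul_comm]
  exact (lattice_abs_sub_le_add _ _).trans (add_le_add e₂
    ((lattice_abs_smul_le _ _).trans (smul_le_smul_of_nonneg_left e₁ (abs_nonneg r))))

/-- A positive multilinear map into a uniformly complete space extends uniquely along embeddings
with relatively uniformly dense range. -/
theorem IsPositive.existsUnique_extension [Fintype ι] (hT : T.IsPositive)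
    (hj : ∀ k, Function.Injective (j k)) (hd : ∀ k, (j k).HasRUDenseRange)
    (hF : UniformlyComplete F) :
    ∃! S : MultilinearMap ℝ B F, S.IsPositive ∧ ∀ a : ∀ k, A k, S (fun k => j k (a k)) = T a := by
  choose V hV using hT.exists_isLimitValue hj hd hF
  let S : MultilinearMap ℝ B F :=
    MultilinearMap.mk' V (fun _ _ _ _ => (hV _).update_add hd (hV _) (hV _))
      (fun _ _ _ _ => (hV _).update_smul hd (hV _))
  refine ⟨S, ⟨fun f hf => (hV f).nonneg hT hd hf, fun a => IsLimitValue.apply_eq j (hV _)⟩, ?_⟩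
  rintro S' ⟨hS', hext⟩
  ext x
  change S' x = V x
  choose Q hQ0 hQ using fun k => (hd k (x k)).exists_abs_le
  obtain ⟨P, hP0, hP⟩ := exists_approx hd x
  obtain ⟨q, hq⟩ := hV x P hP0
  have hjP : ∀ k, 0 ≤ j k (P k) := fun k => by simpa using (j k).map_le_map (hP0 k)
  have hjQ : ∀ k, 0 ≤ j k (Q k) := fun k => by simpa using (j k).map_le_map (hQ0 k)
  refine eq_of_forall_abs_sub_le_smul (q := (Fintype.card ι : ℝ) • T (fun k => Q k + P k) + q)
    fun ε hε hε1 => ?_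
  obtain ⟨a, ha⟩ := hP ε hε
  -- The competitor `S'` is positive, so `S' x` is close to its value `T a` at the approximant, and
  -- so is `V x`.
  have h := hS'.abs_sub_le (f := x) (g := fun k => j k (a k)) (p := fun k => j k (Q k + P k))
    (ε := ε) (fun k => by
      rw [map_add]; exact (hQ k).trans (le_add_of_nonneg_right (hjP k))) (fun k => by
      rw [map_add]
      calc |j k (a k)| = |x k - (x k - j k (a k))| := by simp
        _ ≤ |x k| + |x k - j k (a k)| := lattice_abs_sub_le_add _ _
        _ ≤ _ := add_le_add (hQ k) ((ha k).trans (smul_le_of_le_one_left (hjP k) hε1)))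
    (fun k => (ha k).trans (smul_le_smul_of_nonneg_left (by
      rw [map_add]; exact le_add_of_nonneg_left (hjQ k)) hε.le))
  rw [hext, hext] at h
  refine (lattice_abs_sub_le _ (T a) _).trans ?_
  rw [smul_add, smul_smul, mul_comm ε]
  refine add_le_add h ?_
  rw [abs_sub_comm]
  exact hq ε hε hε1 a ha

end MultilinearMap

end Extension

/-! ### Real-valued homomorphisms via a lattice version of Hahn–Banach. -/

section RealHoms

variable {V : Type*} [AddCommGroup V] [Module ℝ V] [Lattice V]

/-- Monotone sublinear functionals that preserve finite suprema. -/
structure IsSupSublinear (q : V → ℝ) : Prop where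
  add_le : ∀ x y, q (x + y) ≤ q x + q y
  smul_le : ∀ (r : ℝ) (x : V), 0 < r → q (r • x) ≤ r * q x
  mono : Monotone q
  sup_le : ∀ x y, q (x ⊔ y) ≤ max (q x) (q y)

namespace IsSupSublinear

variable {q : V → ℝ}

theorem map_smul (hq : IsSupSublinear q) {r : ℝ} (hr : 0 < r) (x : V) :
    q (r • x) = r * q x := by
  refine le_antisymm (hq.smul_le r x hr) ?_
  have := hq.smul_le r⁻¹ (r • x) (inv_pos.2 hr)
  rw [smul_smul, inv_mul_cancel₀ hr.ne', one_smul] at this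
  rwa [← le_div_iff₀' hr, div_eq_inv_mul]

theorem map_zero (hq : IsSupSublinear q) : q 0 = 0 := by
  have := hq.map_smul (r := 2) two_pos 0
  rw [smul_zero] at this
  linarith

theorem neg_le (hq : IsSupSublinear q) (x : V) : -q (-x) ≤ q x := by
  have := hq.add_le x (-x)
  rw [add_neg_cancel, hq.map_zero] at this
  linarith

/-- The index `k` may depend on the vectors, so this covers both infima of chains and the
directional modification, where the index must be rescaled. -/
theorem iInf {I : Type*} [Nonempty I] {f : I → V → ℝ}
    (hb : ∀ x, BddBelow (Set.range fun i => f i x))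
    (hadd : ∀ i j x y, ∃ k, f k (x + y) ≤ f i x + f j y)
    (hsmul : ∀ i (r : ℝ) x, 0 < r → ∃ k, f k (r • x) ≤ r * f i x)
    (hmono : ∀ i, Monotone (f i))
    (hsup : ∀ i j x y, ∃ k, f k (x ⊔ y) ≤ max (f i x) (f j y)) :
    IsSupSublinear fun x => ⨅ i, f i x where
  add_le x y := by
    refine le_ciInf_add_ciInf fun i j => ?_
    obtain ⟨k, hk⟩ := hadd i j x y
    exact (ciInf_le (hb _) k).trans hk
  smul_le r x hr := by
    rw [Real.mul_iInf_of_nonneg hr.le]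
    refine le_ciInf fun i => ?_
    obtain ⟨k, hk⟩ := hsmul i r x hr
    exact (ciInf_le (hb _) k).trans hk
  mono x y h := ciInf_mono (hb x) fun i => hmono i h
  sup_le x y := by
    refine le_of_forall_gt_imp_ge_of_dense fun c hc => ?_
    rw [max_lt_iff] at hc
    obtain ⟨i, hi⟩ := exists_lt_of_ciInf_lt hc.1
    obtain ⟨j, hj⟩ := exists_lt_of_ciInf_lt hc.2
    obtain ⟨k, hk⟩ := hsup i j x y
    exact (ciInf_le (hb _) k).trans (hk.trans (max_le hi.le hj.le))

/-- Zorn's lemma in the order dual. Pointwise infima of chains are finite because every sublinear `q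
≤ p` is bounded below by `x ↦ -p (-x)`. -/
theorem exists_minimal {p : V → ℝ} (hp : IsSupSublinear p) :
    ∃ q : V → ℝ, IsSupSublinear q ∧ q ≤ p ∧ ∀ q', IsSupSublinear q' → q' ≤ q → q' = q := by
  obtain ⟨m, hm1, hm2⟩ := zorn_le_nonempty₀ (α := (V → ℝ)ᵒᵈ)
    {q | IsSupSublinear (OrderDual.ofDual q) ∧ OrderDual.ofDual q ≤ p} (by
      intro c hcs hc y hy
      have : Nonempty c := ⟨⟨y, hy⟩⟩
      have hb : ∀ x, BddBelow (Set.range fun i : c => OrderDual.ofDual i.1 x) := by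
        refine fun x => ⟨-p (-x), ?_⟩
        rintro _ ⟨⟨i, hi⟩, rfl⟩
        exact (neg_le_neg ((hcs hi).2 _)).trans ((hcs hi).1.neg_le x)
      have hdir : ∀ i j : c, ∃ k : c, OrderDual.ofDual k.1 ≤ OrderDual.ofDual i.1 ∧
          OrderDual.ofDual k.1 ≤ OrderDual.ofDual j.1 := by
        intro i j
        rcases hc.total i.2 j.2 with h | h
        · exact ⟨j, h, le_rfl⟩
        · exact ⟨i, le_rfl, h⟩
      refine ⟨OrderDual.toDual fun x => ⨅ i : c, OrderDual.ofDual i.1 x,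
        ⟨IsSupSublinear.iInf hb ?_ ?_ ?_ ?_, fun x => ?_⟩, fun z hz x => ?_⟩
      · intro i j x y
        obtain ⟨k, h1, h2⟩ := hdir i j
        exact ⟨k, ((hcs k.2).1.add_le x y).trans (add_le_add (h1 x) (h2 y))⟩
      · exact fun i r x hr => ⟨i, (hcs i.2).1.smul_le r x hr⟩
      · exact fun i => (hcs i.2).1.mono
      · intro i j x y
        obtain ⟨k, h1, h2⟩ := hdir i j
        exact ⟨k, ((hcs k.2).1.sup_le x y).trans (max_le_max (h1 x) (h2 y))⟩
      · exact (ciInf_le (hb x) ⟨y, hy⟩).trans ((hcs hy).2 x)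
      · exact ciInf_le (hb x) ⟨z, hz⟩) (OrderDual.toDual p) ⟨hp, le_rfl⟩
  refine ⟨OrderDual.ofDual m, hm2.prop.1, hm2.prop.2, fun q' h1 h2 => ?_⟩
  exact le_antisymm h2 (hm2.2 (y := OrderDual.toDual q') ⟨h1, h2.trans hm2.prop.2⟩ h2)

variable [IsOrderedAddMonoid V]

/-- The directional modification in the proof of the Hahn–Banach theorem. -/
theorem exists_le_neg (hq : IsSupSublinear q) (x : V) :
    ∃ q' : V → ℝ, IsSupSublinear q' ∧ q' ≤ q ∧ q' (-x) ≤ -q x := by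
  -- The infimum over `t` is the new functional: `t = 0` shows that it is at most `q`, and `t = 1`
  -- at `-x` gives the value `-q x`.
  let f : NNReal → V → ℝ := fun t y => q (y + (t : ℝ) • x) - t * q x
  have hsm : ∀ t : NNReal, q ((t : ℝ) • x) = t * q x := by
    intro t
    rcases t.coe_nonneg.eq_or_lt with h | h
    · rw [← h]; simp [hq.map_zero]
    · exact hq.map_smul h x
  have hb : ∀ y, BddBelow (Set.range fun t => f t y) := by
    rintro y
    refine ⟨-q (-y), ?_⟩
    rintro _ ⟨t, rfl⟩
    have h1 := hq.add_le (y + (t : ℝ) • x) (-y)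
    rw [add_neg_cancel_comm, hsm] at h1
    simp only [f]
    linarith
  -- Since `f` decreases in `t`, two indices can be replaced by their sum; preservation of suprema
  -- then follows from translation invariance.
  have hanti : ∀ t s : NNReal, ∀ y, f (t + s) y ≤ f t y := by
    intro t s y
    have h1 := hq.add_le (y + (t : ℝ) • x) ((s : ℝ) • x)
    rw [hsm, add_assoc, ← add_smul] at h1
    simp only [f, NNReal.coe_add]
    linarith
  refine ⟨fun y => ⨅ t, f t y, IsSupSublinear.iInf hb ?_ ?_ ?_ ?_, fun y => ?_, ?_⟩
  · intro t s y z
    refine ⟨t + s, ?_⟩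
    have h1 := hq.add_le (y + (t : ℝ) • x) (z + (s : ℝ) • x)
    rw [add_add_add_comm, ← add_smul] at h1
    simp only [f, NNReal.coe_add]
    linarith
  · intro t r y hr
    refine ⟨r.toNNReal * t, ?_⟩
    have h1 := hq.smul_le r (y + (t : ℝ) • x) hr
    rw [smul_add, smul_smul] at h1
    simp only [f, NNReal.coe_mul, Real.coe_toNNReal r hr.le]
    linarith
  · intro t y z h
    exact sub_le_sub_right (hq.mono (add_le_add_left h _)) _
  · intro t s y z
    refine ⟨t + s, le_trans ?_ (max_le_max (hanti t s y) (add_comm s t ▸ hanti s t z))⟩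
    simp only [f]
    rw [sup_add, max_sub_sub_right]
    exact sub_le_sub_right (hq.sup_le _ _) _
  · exact (ciInf_le (hb y) 0).trans_eq (by simp [f])
  · exact (ciInf_le (hb _) 1).trans_eq (by simp [f, hq.map_zero])

/-- A version of the Hahn–Banach theorem for lattice homomorphisms. -/
theorem exists_hom_eq {p : V → ℝ} (hp : IsSupSublinear p) (w : V) :
    ∃ ω : VectorLatticeHom V ℝ, ω w = p w := by
  -- Modifying at `w` before minimizing forces the final value at `w` to be `p w`.
  obtain ⟨p', hp', hle, hw⟩ := hp.exists_le_neg w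
  obtain ⟨q, hq, hqp, hmin⟩ := hp'.exists_minimal
  -- By minimality the directional modification of `q` is `q` itself, so `q` is odd and therefore
  -- linear.
  have hneg : ∀ x, q (-x) = -q x := by
    intro x
    obtain ⟨q', h1, h2, h3⟩ := hq.exists_le_neg x
    rw [hmin q' h1 h2] at h3
    linarith [hq.neg_le x]
  have hadd : ∀ x y, q (x + y) = q x + q y := by
    intro x y
    refine le_antisymm (hq.add_le x y) ?_
    have := hq.add_le (-x) (-y)
    rw [← neg_add, hneg, hneg, hneg] at this
    linarith
  have hsup : ∀ x y, q (x ⊔ y) = q x ⊔ q y := fun x y =>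
    le_antisymm (hq.sup_le x y) (max_le (hq.mono le_sup_left) (hq.mono le_sup_right))
  refine ⟨{ toFun := q, map_add' := hadd, map_smul' := ?_, map_sup' := hsup, map_inf' := ?_ }, ?_⟩
  · intro r x
    rcases lt_trichotomy r 0 with hr | rfl | hr
    · have := hq.map_smul (neg_pos.2 hr) x
      rw [neg_smul, hneg] at this
      simp only [RingHom.id_apply, smul_eq_mul]
      linarith
    · simp [hq.map_zero]
    · exact hq.map_smul hr x
  · intro x y
    have := hsup (-x) (-y)
    rw [← neg_inf, hneg, hneg, hneg, max_neg_neg, neg_inj] at this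
    exact this
  · have h1 := (hqp (-w)).trans hw
    rw [hneg] at h1
    exact le_antisymm ((hqp w).trans (hle w)) (neg_le_neg_iff.1 h1)

end IsSupSublinear

variable [IsArchimedeanVectorLattice V]

/-- The gauge of an order unit. -/
theorem exists_orderUnit_gauge {u : V} (hu0 : 0 ≤ u) (hu : u ≠ 0)
    (h : ∀ x : V, ∃ C : ℝ, x ≤ C • u) :
    ∃ p : V → ℝ, IsSupSublinear p ∧ ∀ x t, p x ≤ t ↔ x ≤ t • u := by
  let p : V → ℝ := fun x => sInf {t : ℝ | x ≤ t • u}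
  have hb : ∀ x, BddBelow {t : ℝ | x ≤ t • u} := by
    intro x
    obtain ⟨C, hC⟩ := h (-x)
    refine ⟨-C, fun t ht => ?_⟩
    by_contra! hlt
    have h1 : 0 ≤ (t + C) • u := by
      rw [add_smul, ← add_neg_cancel x]
      exact add_le_add ht hC
    have h2 : (t + C) • u ≤ 0 := smul_nonpos_of_nonpos_of_nonneg (by linarith) hu0
    rcases smul_eq_zero.1 (le_antisymm h2 h1) with h3 | h3
    · linarith
    · exact hu h3
  -- The infimum is attained, by the Archimedean property.
  have hmem : ∀ x, x ≤ p x • u := by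
    intro x
    rw [← sub_nonpos]
    refine nonpos_of_forall_le_smul (q := u) fun ε hε _ => ?_
    obtain ⟨t, ht, hlt⟩ := exists_lt_of_csInf_lt (h x) (lt_add_of_pos_right (p x) hε)
    rw [sub_le_iff_le_add, ← add_smul, add_comm]
    exact le_trans ht (smul_le_smul_of_nonneg_right hlt.le hu0)
  have hp : ∀ x t, p x ≤ t ↔ x ≤ t • u := fun x t =>
    ⟨fun ht => (hmem x).trans (smul_le_smul_of_nonneg_right ht hu0), fun ht => csInf_le (hb x) ht⟩
  refine ⟨p, ⟨fun x y => ?_, fun r x hr => ?_, fun x y hxy => ?_, fun x y => ?_⟩, hp⟩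
  · rw [hp, add_smul]
    exact add_le_add (hmem x) (hmem y)
  · rw [hp, mul_smul]
    exact smul_le_smul_of_nonneg_left (hmem x) hr.le
  · rw [hp]
    exact hxy.trans (hmem y)
  · rw [hp]
    exact sup_le ((hp x _).1 (le_max_left _ _)) ((hp y _).1 (le_max_right _ _))

/-- In an Archimedean vector lattice with an order unit, the real-valued lattice homomorphisms
determine the order. -/
theorem nonneg_of_forall_hom_nonneg {u : V} (hu : ∀ x : V, ∃ C : ℝ, x ≤ C • u) {z : V}
    (hz : ∀ ω : VectorLatticeHom V ℝ, (∃ x, ω x ≠ 0) → 0 ≤ ω z) : 0 ≤ z := by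
  by_contra hneg
  have hu' : ∀ x : V, ∃ C : ℝ, x ≤ C • |u| := by
    intro x
    obtain ⟨C, hC⟩ := hu x
    exact ⟨|C|, hC.trans ((le_abs_self _).trans (lattice_abs_smul_le C u))⟩
  have hu0 : |u| ≠ 0 := by
    intro h0
    obtain ⟨C, hC⟩ := hu' (-z)
    rw [h0, smul_zero, neg_nonpos] at hC
    exact hneg hC
  obtain ⟨p, hp, hpu⟩ := exists_orderUnit_gauge (abs_nonneg u) hu0 hu'
  obtain ⟨ω, hω⟩ := hp.exists_hom_eq (-z)
  -- A gauge value `≤ 0` at `-z` would mean `-z ≤ 0`.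
  have hpos : 0 < ω (-z) := by
    rw [hω, ← not_le, hpu, zero_smul, neg_nonpos]
    exact hneg
  have := hz ω ⟨-z, hpos.ne'⟩
  rw [map_neg] at hpos
  linarith

end RealHoms

/-! ### Lattice-linear expressions and Stone–Weierstrass approximation. -/

/-- Lattice-linear expressions in the variables `i : n`. -/
inductive LatticeExpr (n : Type*)
  | var (i : n) : LatticeExpr n
  | zero : LatticeExpr n
  | add (g h : LatticeExpr n) : LatticeExpr n
  | smul (r : ℝ) (g : LatticeExpr n) : LatticeExpr n
  | sup (g h : LatticeExpr n) : LatticeExpr n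

namespace LatticeExpr

variable {n : Type*}

/-- The value of a lattice-linear expression in a vector lattice. -/
def eval {V : Type*} [AddCommGroup V] [Module ℝ V] [Lattice V] (a : n → V) : LatticeExpr n → V
  | var i => a i
  | zero => 0
  | add g h => eval a g + eval a h
  | smul r g => r • eval a g
  | sup g h => eval a g ⊔ eval a h

theorem map_eval {V W : Type*} [AddCommGroup V] [Module ℝ V] [Lattice V]
    [AddCommGroup W] [Module ℝ W] [Lattice W] (T : VectorLatticeHom V W) (a : n → V)
    (g : LatticeExpr n) : T (g.eval a) = g.eval (fun i => T (a i)) := by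
  induction g with
  | var i => rfl
  | zero => exact T.toLinearMap.map_zero
  | add g h hg hh => simp only [eval, map_add, hg, hh]
  | smul r g hg => simp only [eval, map_smul, hg]
  | sup g h hg hh => simp only [eval, T.map_sup, hg, hh]

theorem eval_smul (g : LatticeExpr n) {r : ℝ} (hr : 0 ≤ r) (x : n → ℝ) :
    g.eval (r • x) = r * g.eval x := by
  induction g with
  | var i => rfl
  | zero => simp [eval]
  | add g h hg hh => simp only [eval, hg, hh, mul_add]
  | smul c g hg => simp only [eval, hg, smul_eq_mul]; ring
  | sup g h hg hh => simp only [eval, hg, hh]; exact (mul_max_of_nonneg _ _ hr).symm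

theorem continuous_eval (g : LatticeExpr n) : Continuous fun x : n → ℝ => g.eval x := by
  induction g with
  | var i => exact continuous_apply i
  | zero => exact continuous_const
  | add g h hg hh => exact hg.add hh
  | smul c g hg => exact hg.const_smul c
  | sup g h hg hh => exact hg.max hh

theorem exists_lipschitz (V : Type*) [AddCommGroup V] [Module ℝ V] [Lattice V]
    [IsArchimedeanVectorLattice V] (g : LatticeExpr n) :
    ∃ C : ℝ, 0 ≤ C ∧ ∀ (a b : n → V) (p : V), 0 ≤ p → (∀ i, |a i - b i| ≤ p) →
      |g.eval a - g.eval b| ≤ C • p := by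
  induction g with
  | var i => exact ⟨1, zero_le_one, fun a b p _ h => by simpa [eval] using h i⟩
  | zero => exact ⟨0, le_rfl, fun a b p _ h => by simp [eval]⟩
  | add g h hg hh =>
    obtain ⟨C, hC, hg⟩ := hg
    obtain ⟨D, hD, hh⟩ := hh
    refine ⟨C + D, add_nonneg hC hD, fun a b p hp h => ?_⟩
    simp only [eval]
    rw [add_sub_add_comm, add_smul]
    exact (abs_add_le _ _).trans (add_le_add (hg a b p hp h) (hh a b p hp h))
  | smul r g hg =>
    obtain ⟨C, hC, hg⟩ := hg
    refine ⟨|r| * C, mul_nonneg (abs_nonneg r) hC, fun a b p hp h => ?_⟩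
    simp only [eval]
    rw [← smul_sub, mul_smul]
    exact (lattice_abs_smul_le _ _).trans
      (smul_le_smul_of_nonneg_left (hg a b p hp h) (abs_nonneg r))
  | sup g h hg hh =>
    obtain ⟨C, hC, hg⟩ := hg
    obtain ⟨D, hD, hh⟩ := hh
    refine ⟨C + D, add_nonneg hC hD, fun a b p hp h => ?_⟩
    simp only [eval]
    rw [add_smul]
    exact (lattice_abs_sup_sub_sup_le _ _ _ _).trans (add_le_add (hg a b p hp h) (hh a b p hp h))

/-- This expression equals `1` on the `ℓ¹` sphere and so replaces the constants, which are not
lattice-linear. -/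
theorem exists_eval_eq_sum_abs (S : Finset n) :
    ∃ g : LatticeExpr n, ∀ x : n → ℝ, g.eval x = ∑ i ∈ S, |x i| := by
  classical
  induction S using Finset.induction_on with
  | empty => exact ⟨zero, fun x => by simp [eval]⟩
  | insert i S hi ih =>
    obtain ⟨g, hg⟩ := ih
    refine ⟨add (sup (var i) (smul (-1) (var i))) g, fun x => ?_⟩
    rw [Finset.sum_insert hi, eval, hg]
    simp [eval, abs]

end LatticeExpr

open LatticeExpr

/-- Lattice-linear functions approximate continuous positively homogeneous functions. -/
theorem PosHomFun.exists_approx {m : ℕ} (h : PosHomFun m) {ε : ℝ} (hε : 0 < ε) :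
    ∃ g : LatticeExpr (Fin m), ∀ x : Fin m → ℝ, |h.toFun x - g.eval x| ≤ ε * ∑ i, |x i| := by
  let X : Set (Fin m → ℝ) := {x | ∑ i, |x i| = 1}
  have hcont : Continuous fun x : Fin m → ℝ => ∑ i, |x i| := by fun_prop
  have hX : IsCompact X := by
    refine Metric.isCompact_of_isClosed_isBounded (isClosed_singleton.preimage hcont) ?_
    refine (Metric.isBounded_closedBall (x := (0 : Fin m → ℝ)) (r := 1)).subset fun x hx => ?_
    rw [mem_closedBall_zero_iff, pi_norm_le_iff_of_nonneg zero_le_one]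
    intro i
    rw [Real.norm_eq_abs, ← show ∑ i, |x i| = 1 from hx]
    exact Finset.single_le_sum (f := fun i => |x i|) (fun i _ => abs_nonneg _) (Finset.mem_univ i)
  have : CompactSpace X := isCompact_iff_compactSpace.1 hX
  let L : Set C(X, ℝ) := {f | ∃ g : LatticeExpr (Fin m), ∀ x : X, f x = g.eval x.1}
  have hmem : ∀ g : LatticeExpr (Fin m),
      (⟨fun x => g.eval x.1, g.continuous_eval.comp continuous_subtype_val⟩ : C(X, ℝ)) ∈ L :=
    fun g => ⟨g, fun x => rfl⟩
  obtain ⟨one, hone⟩ := exists_eval_eq_sum_abs (Finset.univ : Finset (Fin m))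
  have hone' : ∀ x : X, one.eval x.1 = 1 := fun x => (hone x.1).trans x.2
  have hL : closure L = ⊤ := by
    refine ContinuousMap.sublattice_closure_eq_top L ⟨_, hmem zero⟩ ?_ ?_ ?_
    · rintro f ⟨g, hg⟩ f' ⟨g', hg'⟩
      refine ⟨smul (-1) (sup (smul (-1) g) (smul (-1) g')), fun x => ?_⟩
      simp [eval, hg, hg', max_neg_neg]
    · rintro f ⟨g, hg⟩ f' ⟨g', hg'⟩
      exact ⟨sup g g', fun x => by simp [eval, hg, hg']⟩
    · intro v x y
      by_cases hxy : x = y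
      · subst hxy
        exact ⟨_, hmem (smul (v x) one), by simp [eval, hone'], by simp [eval, hone']⟩
      · obtain ⟨i, hi⟩ : ∃ i, x.1 i ≠ y.1 i := by
          by_contra! hcon
          exact hxy (Subtype.ext (funext hcon))
        have hi' : y.1 i - x.1 i ≠ 0 := sub_ne_zero.2 hi.symm
        -- Affine interpolation in the coordinate `i` that separates the two points.
        refine ⟨_, hmem (add (smul (v x - (v y - v x) / (y.1 i - x.1 i) * x.1 i) one)
          (smul ((v y - v x) / (y.1 i - x.1 i)) (var i))), ?_, ?_⟩
        · simp [eval, hone']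
        · simp only [ContinuousMap.coe_mk, eval, hone', smul_eq_mul]
          field_simp
          ring
  let f : C(X, ℝ) := ⟨fun x => h.toFun x.1, h.continuous'.comp continuous_subtype_val⟩
  obtain ⟨f', ⟨g, hg⟩, hf'⟩ := Metric.mem_closure_iff.1 (hL ▸ trivial : f ∈ closure L) ε hε
  refine ⟨g, fun x => ?_⟩
  have hs : 0 ≤ ∑ i, |x i| := Finset.sum_nonneg fun i _ => abs_nonneg _
  rcases hs.eq_or_lt with h0 | hpos
  · have hx : x = (0 : ℝ) • x := by
      ext i
      simpa using (Finset.sum_eq_zero_iff_of_nonneg fun i _ => abs_nonneg (x i)).1 h0.symm i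
        (Finset.mem_univ i)
    rw [← h0, hx, h.map_smul' 0 le_rfl, g.eval_smul le_rfl]
    simp
  · set r := ∑ i, |x i| with hr
    have hy : r⁻¹ • x ∈ X := by
      change ∑ i, |r⁻¹ * x i| = 1
      simp_rw [abs_mul, abs_of_pos (inv_pos.2 hpos)]
      rw [← Finset.mul_sum, ← hr, inv_mul_cancel₀ hpos.ne']
    have hd := (ContinuousMap.dist_apply_le_dist (f := f) (g := f') ⟨_, hy⟩).trans hf'.le
    rw [Real.dist_eq, hg] at hd
    have hx : x = r • (r⁻¹ • x) := by rw [smul_smul, mul_inv_cancel₀ hpos.ne', one_smul]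
    rw [hx, h.map_smul' r hs, g.eval_smul hs, ← mul_sub, abs_mul, abs_of_pos hpos, mul_comm]
    exact mul_le_mul_of_nonneg_right hd hs

/-! ### Principal ideals and transfer of the approximation to functional values. -/

namespace VectorSublattice

variable {E : Type*} [AddCommGroup E] [Module ℝ E] [Lattice E]

/-- The inclusion of a vector sublattice. -/
def inclusionHom (L : VectorSublattice E) : VectorLatticeHom L E where
  toLinearMap := L.toSubmodule.subtype
  map_sup' _ _ := rfl
  map_inf' _ _ := rfl

theorem generated_subset {A : Set E} {L : VectorSublattice E} (h : A ⊆ L.carrier) :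
    (generated A).carrier ⊆ L.carrier :=
  fun _ hx => hx L h

variable [IsArchimedeanVectorLattice E]

/-- The principal ideal generated by `u`. -/
def principalIdeal (u : E) : VectorSublattice E where
  carrier := {x | ∃ C : ℝ, |x| ≤ C • u}
  zero_mem' := ⟨0, by simp⟩
  add_mem' := by
    rintro x y ⟨C, hC⟩ ⟨D, hD⟩
    exact ⟨C + D, by rw [add_smul]; exact (abs_add_le x y).trans (add_le_add hC hD)⟩
  smul_mem' := by
    rintro r x ⟨C, hC⟩
    refine ⟨|r| * C, (lattice_abs_smul_le r x).trans ?_⟩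
    rw [mul_smul]
    exact smul_le_smul_of_nonneg_left hC (abs_nonneg r)
  sup_mem' := by
    rintro x y ⟨C, hC⟩ ⟨D, hD⟩
    refine ⟨C + D, le_trans (b := |x| + |y|) ?_ (by rw [add_smul]; exact add_le_add hC hD)⟩
    refine abs_le'.2 ⟨sup_le ?_ ?_, ?_⟩
    · exact (le_abs_self x).trans (le_add_of_nonneg_right (abs_nonneg y))
    · exact (le_abs_self y).trans (le_add_of_nonneg_left (abs_nonneg x))
    · rw [neg_sup]
      exact inf_le_left.trans ((neg_le_abs x).trans (le_add_of_nonneg_right (abs_nonneg y)))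
  inf_mem' := by
    rintro x y ⟨C, hC⟩ ⟨D, hD⟩
    refine ⟨C + D, le_trans (b := |x| + |y|) ?_ (by rw [add_smul]; exact add_le_add hC hD)⟩
    refine abs_le'.2 ⟨?_, ?_⟩
    · exact inf_le_left.trans ((le_abs_self x).trans (le_add_of_nonneg_right (abs_nonneg y)))
    · rw [neg_inf]
      refine sup_le ?_ ?_
      · exact (neg_le_abs x).trans (le_add_of_nonneg_right (abs_nonneg y))
      · exact (neg_le_abs y).trans (le_add_of_nonneg_left (abs_nonneg x))

end VectorSublattice

section FunctionalValues

variable {E : Type*} [AddCommGroup E] [Module ℝ E] [Lattice E] [IsArchimedeanVectorLattice E]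

/-- Functional values are approximated by the values of lattice-linear expressions. -/
theorem IsFunctionalValue.exists_approx {m : ℕ} {h : PosHomFun m} {a : Fin m → E} {b : E}
    (hb : IsFunctionalValue h a b) {ε : ℝ} (hε : 0 < ε) :
    ∃ g : LatticeExpr (Fin m), |b - g.eval a| ≤ ε • ∑ i, |a i| := by
  obtain ⟨g, hg⟩ := h.exists_approx hε
  refine ⟨g, ?_⟩
  let G := VectorSublattice.generated (Set.range a ∪ {b})
  let a' : Fin m → G := fun i => ⟨a i, VectorSublattice.subset_generated _ (Or.inl ⟨i, rfl⟩)⟩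
  let b' : G := ⟨b, VectorSublattice.subset_generated _ (Or.inr rfl)⟩
  have hU : ((∑ i, |a' i| + |b'| : G) : E) = ∑ i, |a i| + |b| := by
    change G.inclusionHom (∑ i, |a' i| + |b'| : G) = _
    rw [map_add, map_sum, G.inclusionHom.map_abs]
    simp only [G.inclusionHom.map_abs]
    rfl
  -- The principal ideal of `∑ |a i| + |b|` contains the generators, hence all of `G`. The term
  -- `|b|` is included because no bound of `b` by the `a i` is known yet.
  have hunit : ∀ x : G, ∃ C : ℝ, x ≤ C • (∑ i, |a' i| + |b'|) := by
    intro x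
    have hs : 0 ≤ ∑ i, |a i| := Finset.sum_nonneg fun i _ => abs_nonneg _
    have hle : (Set.range a ∪ {b}) ⊆
        (VectorSublattice.principalIdeal (∑ i, |a i| + |b|)).carrier := by
      rintro _ (⟨i, rfl⟩ | rfl)
      · refine ⟨1, ?_⟩
        rw [one_smul]
        exact (Finset.single_le_sum (f := fun i => |a i|) (fun i _ => abs_nonneg _)
          (Finset.mem_univ i)).trans (le_add_of_nonneg_right (abs_nonneg _))
      · exact ⟨1, by rw [one_smul]; exact le_add_of_nonneg_left hs⟩
    obtain ⟨C, hC⟩ := VectorSublattice.generated_subset hle x.2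
    refine ⟨C, ?_⟩
    change (x : E) ≤ C • ((∑ i, |a' i| + |b'| : G) : E)
    rw [hU]
    exact (le_abs_self _).trans hC
  have key : 0 ≤ ε • ∑ i, |a' i| - |b' - g.eval a'| := by
    refine nonneg_of_forall_hom_nonneg hunit fun ω hω => ?_
    have h1 : h.toFun (fun i => ω (a' i)) = ω b' := hb ω hω
    rw [map_sub, map_smul, map_sum, ω.map_abs, map_sub, LatticeExpr.map_eval, ← h1, sub_nonneg]
    simp only [ω.map_abs]
    exact hg _
  have := G.inclusionHom.map_le_map (sub_nonneg.1 key)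
  rw [map_smul, map_sum, G.inclusionHom.map_abs, map_sub, LatticeExpr.map_eval] at this
  simp only [G.inclusionHom.map_abs] at this
  exact this

end FunctionalValues

/-! ### Relatively uniform density of `φ(E)` in `E^D`. -/

namespace VectorLatticeHom

variable {A B : Type*} [AddCommGroup A] [Module ℝ A] [Lattice A]
  [AddCommGroup B] [Module ℝ B] [Lattice B]

theorem functionalEmbedding_injective (D : Set (Σ m : ℕ+, PosHomFun m))
    {j : VectorLatticeHom A B} (hj : Function.Injective j) :
    Function.Injective (functionalEmbedding D j) :=
  fun _ _ h => hj (congrArg Subtype.val h)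

variable [IsArchimedeanVectorLattice B]

theorem isRULimit_apply (j : VectorLatticeHom A B) (a : A) : j.IsRULimit (j a) :=
  ⟨0, fun ε _ => ⟨a, by simp⟩⟩

variable [IsArchimedeanVectorLattice A]

/-- The relatively uniform limits of elements of the range of `j`, with regulators in the range. -/
def ruClosure (j : VectorLatticeHom A B) : VectorSublattice B where
  carrier := {x | j.IsRULimit x}
  zero_mem' := ⟨0, fun ε _ => ⟨0, by simp⟩⟩
  add_mem' := by
    rintro x y ⟨p, hp⟩ ⟨q, hq⟩
    refine ⟨p + q, fun ε hε => ?_⟩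
    obtain ⟨a, ha⟩ := hp ε hε
    obtain ⟨b, hb⟩ := hq ε hε
    refine ⟨a + b, ?_⟩
    rw [map_add, map_add, smul_add, add_sub_add_comm]
    exact (abs_add_le _ _).trans (add_le_add ha hb)
  smul_mem' := by
    rintro r x ⟨p, hp⟩
    refine ⟨|r| • p, fun ε hε => ?_⟩
    obtain ⟨a, ha⟩ := hp ε hε
    refine ⟨r • a, ?_⟩
    rw [map_smul, map_smul, ← smul_sub, smul_comm]
    exact (lattice_abs_smul_le _ _).trans (smul_le_smul_of_nonneg_left ha (abs_nonneg r))
  sup_mem' := by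
    rintro x y ⟨p, hp⟩ ⟨q, hq⟩
    refine ⟨p + q, fun ε hε => ?_⟩
    obtain ⟨a, ha⟩ := hp ε hε
    obtain ⟨b, hb⟩ := hq ε hε
    refine ⟨a ⊔ b, ?_⟩
    rw [map_add, j.map_sup, smul_add]
    exact (lattice_abs_sup_sub_sup_le _ _ _ _).trans (add_le_add ha hb)
  inf_mem' := by
    rintro x y ⟨p, hp⟩ ⟨q, hq⟩
    refine ⟨p + q, fun ε hε => ?_⟩
    obtain ⟨a, ha⟩ := hp ε hε
    obtain ⟨b, hb⟩ := hq ε hε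
    refine ⟨a ⊓ b, ?_⟩
    rw [map_add, show j (a ⊓ b) = j a ⊓ j b from j.map_inf' a b, smul_add]
    exact (lattice_abs_inf_sub_inf_le _ _ _ _).trans (add_le_add ha hb)

/-- The chain is `b ≈ g(a) ≈ g(j f) = j (g f)`. In the regulator, the `q i` dominate `|a i|` for the
first step and the `p i` control the approximations of `a i` for the second. -/
theorem IsRULimit.of_isFunctionalValue {j : VectorLatticeHom A B} {m : ℕ} {h : PosHomFun m}
    {a : Fin m → B} {b : B} (ha : ∀ i, j.IsRULimit (a i)) (hb : IsFunctionalValue h a b) :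
    j.IsRULimit b := by
  choose p hp0 hp using fun i => (ha i).exists_regulator
  choose q hq0 hq using fun i => (ha i).exists_abs_le
  have hjp : ∀ i, 0 ≤ j (p i) := fun i => by simpa using j.map_le_map (hp0 i)
  have hjq : ∀ i, 0 ≤ j (q i) := fun i => by simpa using j.map_le_map (hq0 i)
  have hQ : j (∑ i, (p i + q i)) = ∑ i, j (p i) + ∑ i, j (q i) := by
    rw [map_sum, ← Finset.sum_add_distrib]
    simp only [map_add]
  have hsp : 0 ≤ ∑ i, j (p i) := Finset.sum_nonneg fun i _ => hjp i
  have hsq : 0 ≤ ∑ i, j (q i) := Finset.sum_nonneg fun i _ => hjq i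
  refine ⟨∑ i, (p i + q i), fun ε hε => ?_⟩
  obtain ⟨g, hg⟩ := hb.exists_approx (half_pos hε)
  obtain ⟨C, hC, hlip⟩ := g.exists_lipschitz B
  have hC1 : 0 < C + 1 := by positivity
  -- The tolerance absorbs the Lipschitz constant `C` of `g`; `C + 1` avoids division by `0`.
  have hδ : 0 < ε / 2 / (C + 1) := by positivity
  choose f hf using fun i => hp i _ hδ
  refine ⟨g.eval f, ?_⟩
  rw [LatticeExpr.map_eval]
  refine (lattice_abs_sub_le _ (g.eval a) _).trans ?_
  rw [show ε • j (∑ i, (p i + q i)) =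
    (ε / 2) • j (∑ i, (p i + q i)) + (ε / 2) • j (∑ i, (p i + q i)) by module]
  refine add_le_add (hg.trans (smul_le_smul_of_nonneg_left ?_ (half_pos hε).le)) ?_
  · rw [hQ]
    exact (Finset.sum_le_sum fun i _ => hq i).trans (le_add_of_nonneg_left hsp)
  · refine (hlip a (fun i => j (f i)) ((ε / 2 / (C + 1)) • j (∑ i, (p i + q i))) ?_ ?_).trans ?_
    · rw [hQ]
      exact smul_nonneg hδ.le (add_nonneg hsp hsq)
    · refine fun i => (hf i).trans (smul_le_smul_of_nonneg_left ?_ hδ.le)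
      rw [hQ]
      exact (Finset.single_le_sum (f := fun i => j (p i)) (fun i _ => hjp i)
        (Finset.mem_univ i)).trans (le_add_of_nonneg_right hsq)
    · rw [smul_smul]
      refine smul_le_smul_of_nonneg_right ?_ (by rw [hQ]; exact add_nonneg hsp hsq)
      rw [mul_div_assoc', div_le_iff₀ hC1]
      nlinarith

theorem functionalStage_subset_ruClosure (D : Set (Σ m : ℕ+, PosHomFun m))
    (j : VectorLatticeHom A B) (n : ℕ) :
    (functionalStage D j n).carrier ⊆ j.ruClosure.carrier := by
  induction n with
  | zero =>
    rintro _ ⟨a, rfl⟩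
    exact j.isRULimit_apply a
  | succ n ih =>
    refine VectorSublattice.generated_subset (Set.union_subset ih ?_)
    rintro b ⟨h, -, a, ha, hb⟩
    exact IsRULimit.of_isFunctionalValue (fun i => ih (ha i)) hb

theorem hasRUDenseRange_functionalEmbedding (D : Set (Σ m : ℕ+, PosHomFun m))
    (j : VectorLatticeHom A B) : (functionalEmbedding D j).HasRUDenseRange := by
  intro x
  obtain ⟨n, hn⟩ := Set.mem_iUnion.1 x.2
  obtain ⟨p, hp⟩ := functionalStage_subset_ruClosure D j n hn
  refine ⟨p, fun ε hε => ?_⟩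
  obtain ⟨a, ha⟩ := hp ε hε
  refine ⟨a, ?_⟩
  change (functionalCompletion D j).inclusionHom |_| ≤ _
  rw [VectorLatticeHom.map_abs]
  exact ha

end VectorLatticeHom

theorem proposition3p17 {s : ℕ} (hs : 1 ≤ s)
    {E : Fin s → Type*} [∀ k, AddCommGroup (E k)] [∀ k, Module ℝ (E k)] [∀ k, Lattice (E k)]
    [∀ k, IsArchimedeanVectorLattice (E k)]
    {Eu : Fin s → Type*} [∀ k, AddCommGroup (Eu k)] [∀ k, Module ℝ (Eu k)]
    [∀ k, Lattice (Eu k)] [∀ k, IsArchimedeanVectorLattice (Eu k)]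
    (φ : ∀ k, VectorLatticeHom (E k) (Eu k)) (hφ : ∀ k, IsUniformCompletion (φ k))
    {F : Type*} [AddCommGroup F] [Module ℝ F] [Lattice F] [IsArchimedeanVectorLattice F]
    (hF : UniformlyComplete F)
    (D : Set (Σ m : ℕ+, PosHomFun m)) (hD : D.Nonempty)
    (T : MultilinearMap ℝ E F) (hT : T.IsPositive) :
    ∃! TD : MultilinearMap ℝ (fun k => functionalCompletion D (φ k)) F,
      TD.IsPositive ∧
        ∀ f : ∀ k, E k, TD (fun k => functionalEmbedding D (φ k) (f k)) = T f :=
  hT.existsUnique_extension (fun k => VectorLatticeHom.functionalEmbedding_injective D (hφ k).injective)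
    (fun k => VectorLatticeHom.hasRUDenseRange_functionalEmbedding D (φ k)) hF
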